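/- Let $G=(V,E)$ be a finite or countably infinite simple graph, and consider Bernoulli bond percolation on $G$: the edges $e\in E$ are open independently of each other, each with its own probability $p_e\in[0,1]$. Two vertices are in the same cluster if they are joined by a path of open edges. For a list of blocks of vertices separated by $\|$, let $v_{11}\dots v_{1i_1}\|\dots\|v_{n1}\dots v_{ni_n}$ denote the event that the vertices of each block lie in one cluster and that the clusters of different blocks are different. Then for all vertices $a,b,c\in V$ (not necessarily distinct) $$\mathbb P(a\|b\,\cap\,a\|c)\,\mathbb P(ab\cup ac)\;\le\;\mathbb P(ab\|c)+\mathbb P(ac\|b)+\mathbb P(a\|bc)-\mathbb P(ab\|c)^2-\mathbb P(ac\|b)^2,$$ and the right-hand side is at most $\mathbb P(ab\|c)+\mathbb P(ac\|b)+\mathbb P(a\|bc)$. Moreover, let $\alpha_3$ be the supremum of $\min\big(\mathbb P(abc),\mathbb P(a\|b\|c)\big)$ over all such bond percolations, on all finite or countable graphs, and all choices of vertices $a,b,c$. Then $\alpha_3\le 0.369$. -/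

import Mathlib

open MeasureTheory ProbabilityTheory

namespace BondPercolation

/-- A configuration of bond percolation on `G`: each edge is open (`true`) or closed (`false`). -/
abbrev Config {V : Type*} (G : SimpleGraph V) : Type _ := G.edgeSet → Bool

/-- Bernoulli bond percolation on `G`: the edges are open independently of each other, the edge `e`
with its own probability `p e`. -/
noncomputable def law {V : Type*} (G : SimpleGraph V) (p : G.edgeSet → unitInterval) :
    Measure (Config G) :=
  Measure.infinitePi fun e => bernoulliMeasure true false (p e)

/-- The random subgraph of `G` formed by the open edges. -/
def openGraph {V : Type*} {G : SimpleGraph V} (ω : Config G) : SimpleGraph V where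
  Adj u v := ∃ h : G.Adj u v, ω ⟨s(u, v), h⟩ = true
  symm := ⟨fun u v ⟨h, hω⟩ => ⟨h.symm, by
    have : (⟨s(v, u), h.symm⟩ : G.edgeSet) = ⟨s(u, v), h⟩ := Subtype.ext Sym2.eq_swap
    rw [this]; exact hω⟩⟩
  loopless := ⟨fun u ⟨h, _⟩ => G.loopless.irrefl u h⟩

/-- `u` and `v` belong to the same cluster: some path of open edges joins them. -/
def Connected {V : Type*} {G : SimpleGraph V} (ω : Config G) (u v : V) : Prop :=
  (openGraph ω).Reachable u v

/-- The event written `v₁₁…v₁ᵢ ‖ v₂₁…v₂ⱼ ‖ …`: the vertices in each block of the list lie in one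
cluster, and the clusters of different blocks are different. -/
def clusterEvent {V : Type*} (G : SimpleGraph V) (L : List (List V)) : Set (Config G) :=
  {ω | (∀ B ∈ L, ∀ u ∈ B, ∀ v ∈ B, Connected ω u v) ∧
    L.Pairwise fun B B' => ∀ u ∈ B, ∀ v ∈ B', ¬ Connected ω u v}

/-- The probability of an event under Bernoulli bond percolation. -/
noncomputable def prob {V : Type*} {G : SimpleGraph V} (p : G.edgeSet → unitInterval)
    (A : Set (Config G)) : ℝ :=
  (law G p).real A

instance {V : Type*} (G : SimpleGraph V) (p : G.edgeSet → unitInterval) :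
    IsProbabilityMeasure (law G p) := by
  unfold law; infer_instance

/-- On a countable graph, the connection events are measurable. -/
theorem measurableSet_connected {V : Type*} [Countable V] (G : SimpleGraph V) (u v : V) :
    MeasurableSet {ω : Config G | Connected ω u v} := by
  have hadj : ∀ x y : V, MeasurableSet {ω : Config G | (openGraph ω).Adj x y} := by
    intro x y
    by_cases h : G.Adj x y
    · have : {ω : Config G | (openGraph ω).Adj x y} =
          (fun ω : Config G => ω ⟨s(x, y), h⟩) ⁻¹' {true} := by
        ext ω; simp [openGraph, h]
      rw [this]
      exact measurable_pi_apply _ (measurableSet_singleton _)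
    · have : {ω : Config G | (openGraph ω).Adj x y} = ∅ := by
        ext ω; simp [openGraph, h]
      rw [this]; exact MeasurableSet.empty
  have hwalk : ∀ (n : ℕ) (x : V),
      MeasurableSet {ω : Config G | ∃ w : (openGraph ω).Walk x v, w.length = n} := by
    intro n
    induction n with
    | zero =>
      intro x
      by_cases h : x = v
      · subst h
        have : {ω : Config G | ∃ w : (openGraph ω).Walk x x, w.length = 0} = Set.univ :=
          Set.eq_univ_of_forall fun _ => ⟨SimpleGraph.Walk.nil, rfl⟩
        rw [this]; exact MeasurableSet.univ
      · have : {ω : Config G | ∃ w : (openGraph ω).Walk x v, w.length = 0} = ∅ :=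
          Set.eq_empty_of_forall_notMem fun _ ⟨_, hw⟩ =>
            h (SimpleGraph.Walk.eq_of_length_eq_zero hw)
        rw [this]; exact MeasurableSet.empty
    | succ n ih =>
      intro x
      have : {ω : Config G | ∃ w : (openGraph ω).Walk x v, w.length = n + 1} =
          ⋃ y : V, {ω : Config G | (openGraph ω).Adj x y} ∩
            {ω : Config G | ∃ w : (openGraph ω).Walk y v, w.length = n} := by
        ext ω
        simp only [Set.mem_iUnion, Set.mem_inter_iff]
        constructor
        · rintro ⟨w, hw⟩
          cases w with
          | nil => simp at hw
          | cons h q => exact ⟨_, h, q, by simpa using hw⟩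
        · rintro ⟨y, h, q, hq⟩
          exact ⟨SimpleGraph.Walk.cons h q, by simp [hq]⟩
      rw [this]
      exact MeasurableSet.iUnion fun y => (hadj x y).inter (ih y)
  have : {ω : Config G | Connected ω u v} =
      ⋃ n : ℕ, {ω : Config G | ∃ w : (openGraph ω).Walk u v, w.length = n} := by
    ext ω
    simp only [Set.mem_iUnion]
    exact ⟨fun ⟨w⟩ => ⟨w.length, w, rfl⟩, fun ⟨_, w, _⟩ => ⟨w⟩⟩
  rw [this]
  exact MeasurableSet.iUnion fun n => hwalk n u

/-- The values of `min (P(abc)) (P(a‖b‖c))` over all Bernoulli bond percolations on countable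
graphs and all vertices `a`, `b`, `c`. -/
def alpha3Values : Set ℝ :=
  {x : ℝ | ∃ (V : Type) (_ : Countable V) (G : SimpleGraph V) (p : G.edgeSet → unitInterval)
    (a b c : V),
    x = min (prob p (clusterEvent G [[a, b, c]])) (prob p (clusterEvent G [[a], [b], [c]]))}

/-- The constant `α₃`: the supremum of the possible values of `min (P(abc)) (P(a‖b‖c))`. -/
noncomputable def alpha3 : ℝ := sSup alpha3Values

/-- The supremum defining `α₃` is a genuine one. -/
theorem isLUB_alpha3 : IsLUB alpha3Values alpha3 := by
  refine isLUB_csSup ?_ ?_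
  · exact ⟨_, Unit, inferInstance, ⊥, fun _ => 0, (), (), (), rfl⟩
  · refine ⟨1, ?_⟩
    rintro x ⟨V, _, G, p, a, b, c, rfl⟩
    exact (min_le_left _ _).trans measureReal_le_one

end BondPercolation

/-! Write A, B, C, t for the probabilities of ab, ac, bc, abc. Expanded, the first inequality is
equivalent to 2t - C + t² ≤ 2AB (`prob_connected_le`). Here 2AB - t² is the probability that, in two
independent copies, a is joined to one of b, c in the first copy and to the other in the second,
while 2t - C is an expectation over a single configuration.

The two are compared by exploring the cluster of a in the first copy: initially the copies share
every edge, and each edge is split into two independent ones when the exploration reaches it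
(`expect_interp_le`). The functional `interp` is chosen so that no split lowers its expectation
(`interp_split`). If the remaining shared edges join b to c, a split preserves it exactly. Otherwise
it asks for edge-disjoint connections; the critical case is an edge linking the components of b and
c, and disjointness of these components then supplies the connections
(`disjointlyJoined_of_bridge`). Once no unexplored edge meets the explored set, the two copies may
be taken independent.

Finite edge sets exhaust a countable graph, which gives the general case. Summing the inequality
over the three choices of base vertex bounds α₃ by a root of a quadratic. -/

namespace BondPercolation

/-! ### Connections by sets of edges -/

section Finite

variable {V ε : Type*} (ends : ε → Sym2 V)

/-- Two vertices are joined by a path using only edges from `F`. -/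
def Joined (F : Set ε) (u v : V) : Prop :=
  (SimpleGraph.fromEdgeSet (ends '' F)).Reachable u v

variable {ends}

theorem Joined.refl (F : Set ε) (u : V) : Joined ends F u u := SimpleGraph.Reachable.refl u

theorem Joined.symm {F : Set ε} {u v : V} (h : Joined ends F u v) : Joined ends F v u :=
  SimpleGraph.Reachable.symm h

theorem Joined.trans {F : Set ε} {u v w : V} (h : Joined ends F u v) (h' : Joined ends F v w) :
    Joined ends F u w :=
  SimpleGraph.Reachable.trans h h'

theorem Joined.mono {F F' : Set ε} (hF : F ⊆ F') {u v : V} (h : Joined ends F u v) :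
    Joined ends F' u v :=
  SimpleGraph.Reachable.mono (SimpleGraph.fromEdgeSet_mono (Set.image_mono hF)) h

theorem joined_of_mem {F : Set ε} {e : ε} {u v : V} (he : e ∈ F) (h : ends e = s(u, v)) :
    Joined ends F u v := by
  -- `fromEdgeSet` drops loops, so a loop needs its own case.
  by_cases huv : u = v
  · subst huv; exact Joined.refl _ _
  · exact SimpleGraph.Adj.reachable
      ((SimpleGraph.fromEdgeSet_adj _).2 ⟨⟨e, he, h⟩, huv⟩)

/-- Induction along a path towards a fixed endpoint. -/
theorem Joined.head_induction {F : Set ε} {v : V} {motive : V → Prop} {u : V}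
    (h : Joined ends F u v) (base : motive v)
    (step : ∀ x y, ∀ e ∈ F, ends e = s(x, y) → Joined ends F y v → motive y → motive x) :
    motive u := by
  obtain ⟨w⟩ := h
  induction w with
  | nil => exact base
  | cons hadj q ih =>
    obtain ⟨⟨e, he, hends⟩, -⟩ := (SimpleGraph.fromEdgeSet_adj _).1 hadj
    exact step _ _ e he hends ⟨q⟩ (ih base step)

theorem Joined.of_insert {F : Set ε} {e : ε} {u w x y : V} (he : ends e = s(u, w))
    (h : Joined ends (insert e F) x y) :
    Joined ends F x y ∨ (Joined ends F x u ∧ Joined ends F w y) ∨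
      (Joined ends F x w ∧ Joined ends F u y) := by
  refine h.head_induction (motive := fun x => Joined ends F x y ∨
    (Joined ends F x u ∧ Joined ends F w y) ∨ (Joined ends F x w ∧ Joined ends F u y))
    (Or.inl (Joined.refl _ _)) ?_
  intro x x' g hg hends _ ih
  rcases hg with rfl | hg
  · rw [he, Sym2.eq_iff] at hends
    rcases hends with ⟨rfl, rfl⟩ | ⟨rfl, rfl⟩
    · rcases ih with ih | ⟨-, ih⟩ | ⟨-, ih⟩
      · exact Or.inr (Or.inl ⟨Joined.refl _ _, ih⟩)
      · exact Or.inr (Or.inl ⟨Joined.refl _ _, ih⟩)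
      · exact Or.inl ih
    · rcases ih with ih | ⟨-, ih⟩ | ⟨-, ih⟩
      · exact Or.inr (Or.inr ⟨Joined.refl _ _, ih⟩)
      · exact Or.inl ih
      · exact Or.inr (Or.inr ⟨Joined.refl _ _, ih⟩)
  · have hx := joined_of_mem hg hends
    rcases ih with ih | ⟨ih, ih'⟩ | ⟨ih, ih'⟩
    · exact Or.inl (hx.trans ih)
    · exact Or.inr (Or.inl ⟨hx.trans ih, ih'⟩)
    · exact Or.inr (Or.inr ⟨hx.trans ih, ih'⟩)

/-- A path towards `y` stays in the component of `y`. -/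
theorem Joined.inside {F : Set ε} {x y : V} (h : Joined ends F x y) :
    Joined ends {g ∈ F | ∀ v ∈ ends g, Joined ends F v y} x y := by
  refine h.head_induction (motive := fun x =>
    Joined ends {g ∈ F | ∀ v ∈ ends g, Joined ends F v y} x y) (Joined.refl _ _) ?_
  intro x x' g hg hends hj ih
  have hmem : g ∈ {g ∈ F | ∀ v ∈ ends g, Joined ends F v y} := by
    refine ⟨hg, fun v hv => ?_⟩
    rw [hends, Sym2.mem_iff] at hv
    rcases hv with rfl | rfl
    · exact (joined_of_mem hg hends).trans hj
    · exact hj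
  exact (joined_of_mem hmem hends).trans ih

/-- A path in `D ∪ S` to a union `K` of components of `S` reaches `K` before using any edge of `S`
that touches `K`. -/
theorem Joined.first_hit {D S : Set ε} {K : Set V} {x y : V} (h : Joined ends (D ∪ S) x y)
    (hy : y ∈ K) (hK : ∀ u v, Joined ends S u v → v ∈ K → u ∈ K) :
    ∃ k ∈ K, Joined ends (D ∪ {g ∈ S | ∀ v ∈ ends g, v ∉ K}) x k := by
  refine h.head_induction (motive := fun x =>
    ∃ k ∈ K, Joined ends (D ∪ {g ∈ S | ∀ v ∈ ends g, v ∉ K}) x k) ?_ ?_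
  · exact ⟨y, hy, Joined.refl _ _⟩
  rintro x x' g hg hends - ⟨k, hk, ih⟩
  -- Inside `K` the path can restart at `x`; outside, an edge of `S` at `x` has neither end in `K`.
  by_cases hx : x ∈ K
  · exact ⟨x, hx, Joined.refl _ _⟩
  · refine ⟨k, hk, (joined_of_mem (e := g) ?_ hends).trans ih⟩
    rcases hg with hg | hg
    · exact Or.inl hg
    · refine Or.inr ⟨hg, ?_⟩
      intro v hv
      rw [hends, Sym2.mem_iff] at hv
      rcases hv with rfl | rfl
      · exact hx
      · exact fun h' => hx (hK _ _ (joined_of_mem hg hends) h')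

/-! ### The interpolating functional -/

variable (ends)

/-- Some vertex of `X` is joined to `v` by edges from `F`. -/
def SetJoined (F : Set ε) (X : Set V) (v : V) : Prop := ∃ x ∈ X, Joined ends F x v

/-- Edge-disjoint connections inside `S`: `X` is joined to `v`, and, with the additional help of
the edges `D`, `a` is joined to `v'`. -/
def DisjointlyJoined (a : V) (X : Set V) (D S : Set ε) (v v' : V) : Prop :=
  ∃ P ⊆ S, SetJoined ends P X v ∧ Joined ends (D ∪ (S \ P)) a v'

/-- `X` is joined to one of `b`, `c` by `S₁`, and `a` to the other by `D ∪ S₂`. -/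
def CrossJoined (a b c : V) (X : Set V) (D S₁ S₂ : Set ε) : Prop :=
  (SetJoined ends S₁ X b ∧ Joined ends (D ∪ S₂) a c) ∨
    (SetJoined ends S₁ X c ∧ Joined ends (D ∪ S₂) a b)

open Classical in
/-- The indicator of a proposition. -/
noncomputable def ind (Q : Prop) : ℝ := if Q then 1 else 0

open Classical in
/-- The functional interpolating between one configuration, used for both connections, and two
independent ones: `X` is the explored part of the cluster of `a` in the first copy, `D` is the set
of explored open edges of the second copy, and `S` is the set of open edges that the copies still
share. -/
noncomputable def interp (a b c : V) (X : Set V) (D S : Set ε) : ℝ :=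
  if Joined ends S b c then ind (SetJoined ends S X b) + ind (Joined ends (D ∪ S) a b) - 1
  else ind (DisjointlyJoined ends a X D S b c ∨ DisjointlyJoined ends a X D S c b)

variable {ends}

theorem ind_mono {Q Q' : Prop} (h : Q → Q') : ind Q ≤ ind Q' := by
  unfold ind; split_ifs <;> simp_all

theorem ind_nonneg (Q : Prop) : 0 ≤ ind Q := by unfold ind; split_ifs <;> simp

theorem ind_le_one (Q : Prop) : ind Q ≤ 1 := by unfold ind; split_ifs <;> simp

theorem ind_of_true {Q : Prop} (h : Q) : ind Q = 1 := if_pos h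

theorem ind_of_false {Q : Prop} (h : ¬ Q) : ind Q = 0 := if_neg h

theorem ind_congr {Q Q' : Prop} (h : Q ↔ Q') : ind Q = ind Q' := by rw [propext h]

theorem SetJoined.mono {F F' : Set ε} {X X' : Set V} (hF : F ⊆ F') (hX : X ⊆ X') {v : V}
    (h : SetJoined ends F X v) : SetJoined ends F' X' v := by
  obtain ⟨x, hx, h⟩ := h
  exact ⟨x, hX hx, h.mono hF⟩

theorem setJoined_insert {F : Set ε} {X : Set V} {e : ε} {u w v : V} (he : ends e = s(u, w))
    (hu : u ∈ X) : SetJoined ends (insert e F) X v ↔ SetJoined ends F (insert w X) v := by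
  constructor
  · rintro ⟨x, hx, h⟩
    rcases h.of_insert he with h | ⟨-, h⟩ | ⟨-, h⟩
    · exact ⟨x, Or.inr hx, h⟩
    · exact ⟨w, Or.inl rfl, h⟩
    · exact ⟨u, Or.inr hu, h⟩
  · rintro ⟨x, rfl | hx, h⟩
    · exact ⟨u, hu, (joined_of_mem (Set.mem_insert _ _) he).trans (h.mono (Set.subset_insert _ _))⟩
    · exact ⟨x, hx, h.mono (Set.subset_insert _ _)⟩

theorem DisjointlyJoined.mono {a : V} {X X' : Set V} {D D' S : Set ε} (hX : X ⊆ X') (hD : D ⊆ D')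
    {v v' : V} (h : DisjointlyJoined ends a X D S v v') : DisjointlyJoined ends a X' D' S v v' := by
  obtain ⟨P, hP, h₁, h₂⟩ := h
  exact ⟨P, hP, h₁.mono subset_rfl hX, h₂.mono (Set.union_subset_union_left _ hD)⟩

/-- Monotonicity holds in `X` and `D` only: an edge of `S` joining b to c can lower the value from 0
to -1. -/
theorem interp_mono {a b c : V} {X X' : Set V} {D D' S : Set ε} (hX : X ⊆ X') (hD : D ⊆ D') :
    interp ends a b c X D S ≤ interp ends a b c X' D' S := by
  unfold interp
  split_ifs
  · have h₁ := ind_mono (SetJoined.mono (ends := ends) (subset_refl S) hX (v := b))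
    have h₂ := ind_mono (Joined.mono (ends := ends) (Set.union_subset_union_left S hD)
      (u := a) (v := b))
    linarith
  · exact ind_mono (Or.imp (DisjointlyJoined.mono hX hD) (DisjointlyJoined.mono hX hD))

theorem interp_nonneg {a b c : V} {X : Set V} {D S : Set ε} (h : ¬ Joined ends S b c) :
    0 ≤ interp ends a b c X D S := by
  rw [interp, if_neg h]; exact ind_nonneg _

theorem interp_le_one {a b c : V} {X : Set V} {D S : Set ε} :
    interp ends a b c X D S ≤ 1 := by
  unfold interp
  have := ind_le_one (SetJoined ends S X b)
  have := ind_le_one (Joined ends (D ∪ S) a b)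
  split_ifs
  · linarith
  · exact ind_le_one _

theorem interp_eq_one {a b c : V} {X : Set V} {D S : Set ε} (h : ¬ Joined ends S b c)
    (h' : DisjointlyJoined ends a X D S b c ∨ DisjointlyJoined ends a X D S c b) :
    interp ends a b c X D S = 1 := by
  rw [interp, if_neg h, ind_of_true h']

/-- If an edge from `u ∈ X` to `w` would join the components of `v` and `v'`, and `a` reaches one
of these components, then there are disjoint connections, if necessary with `w` added to `X`. -/
theorem disjointlyJoined_of_bridge {a u w v v' : V} {X : Set V} {D S : Set ε} (hu : u ∈ X)
    (hvv' : ¬ Joined ends S v v') (huv : Joined ends S u v) (hwv' : Joined ends S w v')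
    (ha : Joined ends (D ∪ S) a v ∨ Joined ends (D ∪ S) a v') :
    DisjointlyJoined ends a (insert w X) D S v' v ∨ DisjointlyJoined ends a X D S v v' := by
  set K : Set V := {x | Joined ends S x v ∨ Joined ends S x v'} with hKdef
  have hK : ∀ x y, Joined ends S x y → y ∈ K → x ∈ K := fun x y h hy =>
    hy.imp h.trans h.trans
  have hit : ∃ k ∈ K, Joined ends (D ∪ {g ∈ S | ∀ x ∈ ends g, x ∉ K}) a k := by
    rcases ha with ha | ha
    · exact ha.first_hit (Or.inl (Joined.refl _ _)) hK
    · exact ha.first_hit (Or.inr (Joined.refl _ _)) hK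
  -- Up to its first hit the path uses no shared edge touching either component; from there it stays
  -- in the component of `y`. The component of `y'` is thus left free for `X`.
  have key : ∀ y y' : V, ¬ Joined ends S y y' → y ∈ K → y' ∈ K →
      ∀ k, Joined ends (D ∪ {g ∈ S | ∀ x ∈ ends g, x ∉ K}) a k → Joined ends S k y →
      Joined ends (D ∪ (S \ {g ∈ S | ∀ x ∈ ends g, Joined ends S x y'})) a y := by
    intro y y' hyy' hy hy' k hak hky
    have hsub : ∀ g : ε, ∃ x, x ∈ ends g := fun g => by
      induction ends g with
      | _ p q => exact ⟨p, Sym2.mem_mk_left p q⟩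
    refine (hak.mono ?_).trans (hky.inside.mono ?_)
    · refine Set.union_subset_union_right _ ?_
      rintro g ⟨hg, hgK⟩
      refine ⟨hg, fun h => ?_⟩
      obtain ⟨x, hx⟩ := hsub g
      exact hgK x hx (hK _ _ (h.2 x hx) hy')
    · rintro g ⟨hg, hgy⟩
      refine Or.inr ⟨hg, fun h => ?_⟩
      obtain ⟨x, hx⟩ := hsub g
      exact hyy' ((hgy x hx).symm.trans (h.2 x hx))
  have hvK : v ∈ K := Or.inl (Joined.refl _ _)
  have hvK' : v' ∈ K := Or.inr (Joined.refl _ _)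
  obtain ⟨k, hk, hak⟩ := hit
  rcases hk with hk | hk
  · exact Or.inl ⟨_, fun g hg => hg.1, ⟨w, Or.inl rfl, hwv'.inside⟩,
      key v v' hvv' hvK hvK' k hak hk⟩
  · exact Or.inr ⟨_, fun g hg => hg.1, ⟨u, hu, huv.inside⟩,
      key v' v (fun h => hvv' h.symm) hvK' hvK k hak hk⟩

/-- Edge-disjointness lets `e` serve only one connection: that of `X`, where it is replaced by
adding `w`, or that of `a`, where it moves to `D`. -/
theorem DisjointlyJoined.of_insert {a u w v v' : V} {X : Set V} {D S : Set ε} {e : ε}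
    (he : ends e = s(u, w)) (hu : u ∈ X) (h : DisjointlyJoined ends a X D (insert e S) v v') :
    DisjointlyJoined ends a (insert w X) D S v v' ∨
      DisjointlyJoined ends a X (insert e D) S v v' := by
  obtain ⟨P, hP, h₁, h₂⟩ := h
  by_cases heP : e ∈ P
  · refine Or.inl ⟨P \ {e}, fun g hg => ?_, ?_, h₂.mono ?_⟩
    · exact (hP hg.1).resolve_left hg.2
    · rw [← setJoined_insert he hu]
      exact h₁.mono (by simp) subset_rfl
    · rintro g (hg | ⟨rfl | hg, hgP⟩)
      · exact Or.inl hg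
      · exact absurd heP hgP
      · exact Or.inr ⟨hg, fun h => hgP h.1⟩
  · refine Or.inr ⟨P, fun g hg => (hP hg).resolve_left (fun h => heP (h ▸ hg)), h₁, h₂.mono ?_⟩
    rintro g (hg | ⟨rfl | hg, hgP⟩)
    · exact Or.inl (Or.inr hg)
    · exact Or.inl (Or.inl rfl)
    · exact Or.inr ⟨hg, hgP⟩

/-- Splitting an edge from the explored cluster into two independent copies does not decrease the
interpolating functional. -/
theorem interp_split {a b c u w : V} {X : Set V} {D S : Set ε} {e : ε}
    (he : ends e = s(u, w)) (hu : u ∈ X) :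
    interp ends a b c X D (insert e S) ≤ interp ends a b c (insert w X) (insert e D) S ∧
    interp ends a b c X D (insert e S) + interp ends a b c X D S ≤
      interp ends a b c (insert w X) D S + interp ends a b c X (insert e D) S := by
  have hX : X ⊆ insert w X := Set.subset_insert _ _
  have hD : D ⊆ insert e D := Set.subset_insert _ _
  have m₁ := interp_mono (ends := ends) (a := a) (b := b) (c := c) (S := S) hX (subset_refl D)
  have m₂ := interp_mono (ends := ends) (a := a) (b := b) (c := c) (S := S) (subset_refl X) hD
  have m₃ := interp_mono (ends := ends) (a := a) (b := b) (c := c) (S := S) hX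
    (subset_refl (insert e D))
  have m₄ := interp_mono (ends := ends) (a := a) (b := b) (c := c) (S := S)
    (subset_refl (insert w X)) hD
  -- Here `interp` is a term in `X` plus a term in `D`, so both inequalities are equalities.
  by_cases hS : Joined ends S b c
  · have hS' : Joined ends (insert e S) b c := hS.mono (Set.subset_insert _ _)
    have hDS : D ∪ insert e S = insert e D ∪ S := by
      rw [Set.union_insert, Set.insert_union]
    simp only [interp, if_pos hS, if_pos hS', hDS, ind_congr (setJoined_insert he hu)]
    constructor <;> linarith
  · have n₀ := interp_nonneg (ends := ends) (a := a) (X := X) (D := insert e D) hS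
    have n₁ := interp_nonneg (ends := ends) (a := a) (X := insert w X) (D := D) hS
    -- By monotonicity and the bound 1, it is enough that one half-split value is 1 whenever the
    -- unsplit value is positive.
    suffices h : interp ends a b c X D (insert e S) ≤ 0 ∨
        interp ends a b c (insert w X) D S = 1 ∨ interp ends a b c X (insert e D) S = 1 by
      have l := interp_le_one (ends := ends) (a := a) (b := b) (c := c) (X := X) (D := D)
        (S := insert e S)
      rcases h with h | h | h <;> constructor <;> linarith
    -- In this case `e` bridges the components of b and c; a positive value forces `a` to reach one
    -- of them already without `e`.
    by_cases hS' : Joined ends (insert e S) b c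
    · by_cases ha : Joined ends (D ∪ insert e S) a b
      · have ha' : Joined ends (D ∪ S) a b ∨ Joined ends (D ∪ S) a u ∨ Joined ends (D ∪ S) a w := by
          rw [Set.union_insert] at ha
          rcases ha.of_insert he with h | ⟨h, -⟩ | ⟨h, -⟩
          · exact Or.inl h
          · exact Or.inr (Or.inl h)
          · exact Or.inr (Or.inr h)
        refine Or.inr (Or.inl ?_)
        have sub : S ⊆ D ∪ S := Set.subset_union_right
        rcases hS'.of_insert he with h | ⟨hbu, hwc⟩ | ⟨hbw, huc⟩
        · exact absurd h hS
        · have hac : Joined ends (D ∪ S) a b ∨ Joined ends (D ∪ S) a c := by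
            rcases ha' with h | h | h
            · exact Or.inl h
            · exact Or.inl (h.trans (hbu.symm.mono sub))
            · exact Or.inr (h.trans (hwc.mono sub))
          refine interp_eq_one hS ?_
          exact (disjointlyJoined_of_bridge hu hS hbu.symm hwc hac).elim Or.inr
            (fun h => Or.inl (h.mono hX subset_rfl))
        · have hac : Joined ends (D ∪ S) a c ∨ Joined ends (D ∪ S) a b := by
            rcases ha' with h | h | h
            · exact Or.inr h
            · exact Or.inl (h.trans (huc.mono sub))
            · exact Or.inr (h.trans (hbw.symm.mono sub))
          refine interp_eq_one hS ?_
          exact (disjointlyJoined_of_bridge hu (fun h => hS h.symm) huc hbw.symm hac).elim Or.inl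
            (fun h => Or.inr (h.mono hX subset_rfl))
      · left
        rw [interp, if_pos hS', ind_of_false ha]
        have := ind_le_one (SetJoined ends (insert e S) X b)
        linarith
    · by_cases h : DisjointlyJoined ends a X D (insert e S) b c ∨
          DisjointlyJoined ends a X D (insert e S) c b
      · right
        rcases h with h | h
        · rcases h.of_insert he hu with h | h
          · exact Or.inl (interp_eq_one hS (Or.inl h))
          · exact Or.inr (interp_eq_one hS (Or.inl h))
        · rcases h.of_insert he hu with h | h
          · exact Or.inl (interp_eq_one hS (Or.inr h))
          · exact Or.inr (interp_eq_one hS (Or.inr h))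
      · left
        rw [interp, if_neg hS', ind_of_false h]

/-- If no open edge meets `X`, then `X` is joined only to its own vertices. -/
theorem SetJoined.mem {F : Set ε} {X : Set V} {v : V} (hF : ∀ e ∈ F, ∀ x ∈ ends e, x ∉ X)
    (h : SetJoined ends F X v) : v ∈ X := by
  obtain ⟨x, hx, h⟩ := h
  revert hx
  refine h.head_induction (motive := fun x => x ∈ X → v ∈ X) id ?_
  intro x y e he hends _ _ hx
  exact absurd hx (hF e he x (by rw [hends]; exact Sym2.mem_mk_left x y))

/-- With no shared edge meeting `X`, being joined to `X` means lying in `X`, which holds for any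
`S₁`. Hence the first copy can be resampled freely. -/
theorem interp_le_of_explored {a b c : V} {X : Set V} {D S : Set ε}
    (hS : ∀ e ∈ S, ∀ x ∈ ends e, x ∉ X) (S₁ : Set ε) :
    interp ends a b c X D S ≤ ind (CrossJoined ends a b c X D S₁ S) := by
  have self : ∀ v ∈ X, SetJoined ends S₁ X v := fun v hv => ⟨v, hv, Joined.refl _ _⟩
  unfold interp
  split_ifs with hbc
  · by_cases hb : SetJoined ends S X b
    · have hc : SetJoined ends S X c := by
        obtain ⟨x, hx, h⟩ := hb
        exact ⟨x, hx, h.trans hbc⟩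
      have := ind_mono (Q := Joined ends (D ∪ S) a b) (Q' := CrossJoined ends a b c X D S₁ S)
        (fun h => Or.inr ⟨self c (hc.mem hS), h⟩)
      have := ind_le_one (SetJoined ends S X b)
      linarith
    · rw [ind_of_false hb]
      have := ind_le_one (Joined ends (D ∪ S) a b)
      have := ind_nonneg (CrossJoined ends a b c X D S₁ S)
      linarith
  · refine ind_mono ?_
    have aux : ∀ {v v' : V}, DisjointlyJoined ends a X D S v v' →
        SetJoined ends S₁ X v ∧ Joined ends (D ∪ S) a v' := by
      rintro v v' ⟨P, hP, h₁, h₂⟩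
      exact ⟨self v (h₁.mem fun e he => hS e (hP he)),
        h₂.mono (Set.union_subset_union_right _ Set.sdiff_subset)⟩
    exact Or.imp aux aux

/-! ### Expectations over finitely many edges and the interpolation -/

/-- The expectation of a function of the set of open edges among the edges of the finite set `R`,
the edge `e` being open with probability `p e`. -/
noncomputable def expect (p : ε → ℝ) (R : Finset ε) (g : Set ε → ℝ) : ℝ :=
  open Classical in
  ∑ S ∈ R.powerset, (∏ e ∈ S, p e) * (∏ e ∈ R \ S, (1 - p e)) * g S

section Expect

variable {p : ε → ℝ} {R : Finset ε}

open Classical in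
theorem expect_insert {e : ε} (he : e ∉ R) (g : Set ε → ℝ) :
    expect p (insert e R) g =
      p e * expect p R (fun S => g (insert e S)) + (1 - p e) * expect p R g := by
  unfold expect
  rw [Finset.sum_powerset_insert he, add_comm, Finset.mul_sum, Finset.mul_sum]
  congr 1
  · refine Finset.sum_congr rfl fun S hS => ?_
    have heS : e ∉ S := fun h => he (Finset.mem_powerset.1 hS h)
    have : insert e R \ insert e S = R \ S := by
      ext x; simp only [Finset.mem_sdiff, Finset.mem_insert]
      grind
    rw [Finset.prod_insert heS, this, Finset.coe_insert]
    ring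
  · refine Finset.sum_congr rfl fun S hS => ?_
    have heS : e ∉ S := fun h => he (Finset.mem_powerset.1 hS h)
    have : insert e R \ S = insert e (R \ S) := Finset.insert_sdiff_of_notMem _ heS
    rw [this, Finset.prod_insert (fun h => he (Finset.mem_sdiff.1 h).1)]
    ring

theorem expect_mono (h₀ : ∀ e, 0 ≤ p e) (h₁ : ∀ e, p e ≤ 1) {g g' : Set ε → ℝ}
    (h : ∀ S ⊆ (R : Set ε), g S ≤ g' S) : expect p R g ≤ expect p R g' := by
  classical
  unfold expect
  refine Finset.sum_le_sum fun S hS => mul_le_mul_of_nonneg_left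
    (h S (Finset.coe_subset.2 (Finset.mem_powerset.1 hS))) (mul_nonneg ?_ ?_)
  · exact Finset.prod_nonneg fun e _ => h₀ e
  · exact Finset.prod_nonneg fun e _ => sub_nonneg.2 (h₁ e)

theorem expect_add (g g' : Set ε → ℝ) :
    expect p R (fun S => g S + g' S) = expect p R g + expect p R g' := by
  simp only [expect, mul_add, Finset.sum_add_distrib]

theorem expect_const_mul (k : ℝ) (g : Set ε → ℝ) :
    expect p R (fun S => k * g S) = k * expect p R g := by
  simp only [expect, Finset.mul_sum]
  exact Finset.sum_congr rfl fun S _ => by ring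

theorem expect_sub (g g' : Set ε → ℝ) :
    expect p R (fun S => g S - g' S) = expect p R g - expect p R g' := by
  simp only [expect, mul_sub, Finset.sum_sub_distrib]

theorem expect_const (k : ℝ) : expect p R (fun _ => k) = k := by
  classical
  induction R using Finset.induction_on with
  | empty => simp [expect]
  | insert e R he ih => rw [expect_insert he, ih]; ring

end Expect

/-- The interpolation inequality: one shared configuration against two independent ones. -/
theorem expect_interp_le {p : ε → ℝ} (h₀ : ∀ e, 0 ≤ p e) (h₁ : ∀ e, p e ≤ 1) (a b c : V)
    (R : Finset ε) (X : Set V) (D : Set ε) :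
    expect p R (interp ends a b c X D) ≤
      expect p R fun S₁ => expect p R fun S₂ => ind (CrossJoined ends a b c X D S₁ S₂) := by
  classical
  induction hn : R.card generalizing R X D with
  | zero =>
    obtain rfl := Finset.card_eq_zero.1 hn
    refine (expect_mono h₀ h₁ fun S hS => interp_le_of_explored (fun e he => ?_) ∅).trans ?_
    · exact absurd (hS he) (by simp)
    · simp [expect]
  | succ n ih =>
    by_cases hX : ∃ e ∈ R, ∃ u ∈ ends e, u ∈ X
    · obtain ⟨e, heR, u, hue, hu⟩ := hX
      obtain ⟨w, he⟩ := Sym2.mem_iff_exists.1 hue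
      obtain ⟨R', heR', rfl⟩ : ∃ R', e ∉ R' ∧ insert e R' = R :=
        ⟨R.erase e, Finset.notMem_erase e R, Finset.insert_erase heR⟩
      have hcard : R'.card = n := by
        rw [Finset.card_insert_of_notMem heR'] at hn; omega
      have i₁₁ := ih R' (insert w X) (insert e D) hcard
      have i₁₀ := ih R' (insert w X) D hcard
      have i₀₁ := ih R' X (insert e D) hcard
      have i₀₀ := ih R' X D hcard
      have s₁ : expect p R' (fun S => interp ends a b c X D (insert e S)) ≤
          expect p R' (interp ends a b c (insert w X) (insert e D)) :=
        expect_mono h₀ h₁ fun S _ => (interp_split he hu).1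
      have s₂ : expect p R' (fun S => interp ends a b c X D (insert e S)) +
          expect p R' (interp ends a b c X D) ≤
          expect p R' (interp ends a b c (insert w X) D) +
          expect p R' (interp ends a b c X (insert e D)) := by
        rw [← expect_add, ← expect_add]
        exact expect_mono h₀ h₁ fun S _ => (interp_split he hu).2
      have cross : ∀ D S₁ S₂ : Set ε,
          CrossJoined ends a b c X D (insert e S₁) S₂ ↔
            CrossJoined ends a b c (insert w X) D S₁ S₂ := fun D S₁ S₂ => by
        simp only [CrossJoined, setJoined_insert he hu]
      have cross' : ∀ (Y : Set V) (S₁ S₂ : Set ε),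
          CrossJoined ends a b c Y D S₁ (insert e S₂) ↔
            CrossJoined ends a b c Y (insert e D) S₁ S₂ := fun Y S₁ S₂ => by
        simp only [CrossJoined, Set.union_insert, Set.insert_union]
      simp only [expect_insert heR', cross, cross', expect_add, expect_const_mul]
      have q₀ := h₀ e
      have q₁ := sub_nonneg.2 (h₁ e)
      -- With q = 1 - p, the shared average p f₁ + q f₀ equals p² f₁ + pq (f₁ + f₀) + q² f₀; `s₁`
      -- and `s₂` bound the first two brackets.
      nlinarith [mul_nonneg q₀ q₀, mul_nonneg q₀ q₁, mul_nonneg q₁ q₁,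
        mul_le_mul_of_nonneg_left i₁₁ (mul_nonneg q₀ q₀),
        mul_le_mul_of_nonneg_left s₁ (mul_nonneg q₀ q₀),
        mul_le_mul_of_nonneg_left s₂ (mul_nonneg q₀ q₁),
        mul_le_mul_of_nonneg_left i₁₀ (mul_nonneg q₀ q₁),
        mul_le_mul_of_nonneg_left i₀₁ (mul_nonneg q₀ q₁),
        mul_le_mul_of_nonneg_left i₀₀ (mul_nonneg q₁ q₁)]
    · push Not at hX
      rw [← expect_const (p := p) (R := R) (expect p R (interp ends a b c X D))]
      exact expect_mono h₀ h₁ fun S₁ _ => expect_mono h₀ h₁ fun S₂ hS₂ =>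
        interp_le_of_explored (fun e he x hx => hX e (by simpa using hS₂ he) x hx) S₁

/-- The inequality for finitely many edges. -/
theorem expect_joined_le {p : ε → ℝ} (h₀ : ∀ e, 0 ≤ p e) (h₁ : ∀ e, p e ≤ 1) (a b c : V)
    (R : Finset ε) :
    2 * expect p R (fun S => ind (Joined ends S a b ∧ Joined ends S a c)) -
        expect p R (fun S => ind (Joined ends S b c)) +
        expect p R (fun S => ind (Joined ends S a b ∧ Joined ends S a c)) ^ 2 ≤
      2 * expect p R (fun S => ind (Joined ends S a b)) *
        expect p R (fun S => ind (Joined ends S a c)) := by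
  have key := expect_interp_le (ends := ends) h₀ h₁ a b c R {a} ∅
  -- Pointwise there is equality when b and c are joined; otherwise the left side is 0.
  have start : 2 * expect p R (fun S => ind (Joined ends S a b ∧ Joined ends S a c)) -
      expect p R (fun S => ind (Joined ends S b c)) ≤
      expect p R (interp ends a b c {a} ∅) := by
    rw [← expect_const_mul, ← expect_sub]
    refine expect_mono h₀ h₁ fun S _ => ?_
    by_cases hbc : Joined ends S b c
    · have e₁ : (Joined ends S a b ∧ Joined ends S a c) ↔ Joined ends S a b :=
        ⟨And.left, fun h => ⟨h, h.trans hbc⟩⟩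
      have e₂ : SetJoined ends S {a} b ↔ Joined ends S a b := by simp [SetJoined]
      rw [interp, if_pos hbc, ind_of_true hbc, ind_congr e₁, ind_congr e₂, Set.empty_union]
      linarith
    · have e₁ : ¬ (Joined ends S a b ∧ Joined ends S a c) :=
        fun h => hbc (h.1.symm.trans h.2)
      have := interp_nonneg (ends := ends) (a := a) (X := {a}) (D := ∅) hbc
      rw [ind_of_false hbc, ind_of_false e₁]
      linarith
  -- Inclusion-exclusion: both alternatives hold together exactly when abc holds in each copy, which
  -- produces the t² term.
  have cross : ∀ S₁ S₂ : Set ε, ind (CrossJoined ends a b c {a} ∅ S₁ S₂) =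
      ind (Joined ends S₂ a c) * ind (Joined ends S₁ a b) +
        ind (Joined ends S₂ a b) * ind (Joined ends S₁ a c) -
        ind (Joined ends S₂ a b ∧ Joined ends S₂ a c) *
          ind (Joined ends S₁ a b ∧ Joined ends S₁ a c) := by
    intro S₁ S₂
    simp only [CrossJoined, SetJoined, Set.mem_singleton_iff, exists_eq_left, Set.empty_union]
    unfold ind
    by_cases x₁ : Joined ends S₁ a b <;> by_cases y₁ : Joined ends S₁ a c <;>
      by_cases x₂ : Joined ends S₂ a b <;> by_cases y₂ : Joined ends S₂ a c <;>
      simp [x₁, x₂, y₁, y₂]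
  have comm : ∀ (k : ℝ) (g : Set ε → ℝ),
      expect p R (fun S => g S * k) = expect p R g * k := fun k g => by
    simp only [mul_comm _ k, expect_const_mul]
  simp only [cross, expect_sub, expect_add, comm, expect_const_mul] at key
  linarith

end Finite

/-! ### From finite edge sets to countable graphs -/

section Transfer

open Filter Topology

variable {V : Type*} {G : SimpleGraph V}

/-- The open edges among the edges of `R`. -/
def openEdges (R : Finset G.edgeSet) (ω : Config G) : Set G.edgeSet := {e | e ∈ R ∧ ω e = true}

/-- The endpoints of an edge of `G`. -/
abbrev edgeEnds (G : SimpleGraph V) : G.edgeSet → Sym2 V := Subtype.val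

theorem prob_openEdges (p : G.edgeSet → unitInterval) (R : Finset G.edgeSet)
    (Q : Set G.edgeSet → Prop) :
    prob p {ω | Q (openEdges R ω)} = expect (fun e => (p e : ℝ)) R fun S => ind (Q S) := by
  classical
  -- The cylinder on which `S` is exactly the set of open edges of `R`.
  set box : Finset G.edgeSet → Set (Config G) := fun S =>
    Set.pi R fun e => if e ∈ S then {true} else {false} with hbox
  have mem_box : ∀ S ⊆ R, ∀ ω, ω ∈ box S ↔ openEdges R ω = S := by
    intro S hS ω
    simp only [hbox, Set.mem_pi, Finset.mem_coe, openEdges, Set.ext_iff, Set.mem_ofPred_eq]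
    refine forall_congr' fun e => ?_
    by_cases he : e ∈ S
    · simp [he, hS he]
    · simp [he]
  have prob_box : ∀ S ⊆ R, (law G p).real (box S) =
      (∏ e ∈ S, (p e : ℝ)) * ∏ e ∈ R \ S, (1 - (p e : ℝ)) := by
    intro S hS
    rw [measureReal_def, law, Measure.infinitePi_pi _ (fun _ _ => MeasurableSet.of_discrete),
      ENNReal.toReal_prod, ← Finset.prod_sdiff hS, mul_comm]
    congr 1
    · refine Finset.prod_congr rfl fun e he => ?_
      rw [if_pos he]
      exact bernoulliMeasure_real_apply_of_mem_of_notMem _ (by measurability) (by simp) (by simp)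
    · refine Finset.prod_congr rfl fun e he => ?_
      rw [if_neg (Finset.mem_sdiff.1 he).2]
      exact bernoulliMeasure_real_apply_of_notMem_of_mem _ (by measurability) (by simp) (by simp)
  have union : {ω : Config G | Q (openEdges R ω)} =
      ⋃ S ∈ R.powerset.filter fun S : Finset G.edgeSet => Q (S : Set G.edgeSet), box S := by
    ext ω
    simp only [Set.mem_ofPred_eq, Set.mem_iUnion, Finset.mem_filter, Finset.mem_powerset,
      exists_prop]
    constructor
    · intro h
      have hR : R.filter (fun e => ω e = true) ⊆ R := Finset.filter_subset _ _
      have hω : openEdges R ω = (R.filter (fun e => ω e = true) : Finset _) := by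
        ext e; simp [openEdges]
      exact ⟨_, ⟨hR, hω ▸ h⟩, (mem_box _ hR ω).2 hω⟩
    · rintro ⟨S, ⟨hS, hQ⟩, h⟩
      rw [(mem_box S hS ω).1 h]; exact hQ
  rw [prob, union, measureReal_biUnion_finset]
  · rw [expect, Finset.sum_filter]
    refine Finset.sum_congr (by congr) fun S hS => ?_
    rw [prob_box S (Finset.mem_powerset.1 hS), ind]
    split_ifs
    · rw [mul_one]
      congr!
    · rw [mul_zero]
  · intro S hS S' hS' hne
    refine Set.disjoint_left.2 fun ω h h' => hne ?_
    simp only [Finset.coe_filter, Finset.mem_powerset, Set.mem_ofPred_eq] at hS hS'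
    exact Finset.coe_injective (((mem_box S hS.1 ω).1 h).symm.trans ((mem_box S' hS'.1 ω).1 h'))
  · intro S _
    refine MeasurableSet.pi (Finset.countable_toSet R) fun e _ => MeasurableSet.of_discrete

theorem joined_openEdges_mono {R R' : Finset G.edgeSet} (h : R ⊆ R') {ω : Config G} {u v : V}
    (hj : Joined (edgeEnds G) (openEdges R ω) u v) :
    Joined (edgeEnds G) (openEdges R' ω) u v :=
  hj.mono (F' := openEdges R' ω) fun _ he => And.intro (h he.1) he.2

theorem connected_iff_exists_joined (ω : Config G) (u v : V) :
    Connected ω u v ↔ ∃ R, Joined (edgeEnds G) (openEdges R ω) u v := by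
  classical
  constructor
  · rintro ⟨w⟩
    induction w with
    | nil => exact ⟨∅, Joined.refl _ _⟩
    | @cons x y _ hadj q ih =>
      obtain ⟨R, hR⟩ := ih
      obtain ⟨h, hω⟩ := hadj
      have hmem : (⟨s(x, y), h⟩ : G.edgeSet) ∈ openEdges (insert ⟨s(x, y), h⟩ R) ω :=
        ⟨Finset.mem_insert_self _ _, hω⟩
      have hj : Joined (edgeEnds G) (openEdges (insert ⟨s(x, y), h⟩ R) ω) x y :=
        joined_of_mem hmem rfl
      exact ⟨_, hj.trans (joined_openEdges_mono (Finset.subset_insert _ _) hR)⟩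
  · rintro ⟨R, h⟩
    refine h.head_induction (motive := fun x => Connected ω x v) (SimpleGraph.Reachable.refl _) ?_
    intro x y e he hends _ ih
    obtain ⟨e, heG⟩ := e
    obtain rfl : e = s(x, y) := hends
    exact SimpleGraph.Reachable.trans (SimpleGraph.Adj.reachable ⟨heG, he.2⟩) ih

/-- Continuity of measure from below along finite edge sets. Two pairs are carried so that repeating
one also covers single connections. -/
theorem tendsto_prob_joined [Countable V] (p : G.edgeSet → unitInterval) (u v u' v' : V) :
    Tendsto (fun R : Finset G.edgeSet => prob p {ω |
        Joined (edgeEnds G) (openEdges R ω) u v ∧ Joined (edgeEnds G) (openEdges R ω) u' v'})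
      atTop (𝓝 (prob p {ω : Config G | Connected ω u v ∧ Connected ω u' v'})) := by
  classical
  have : Countable (Sym2 V) := Quot.mk_surjective.countable
  have hm : Monotone fun R : Finset G.edgeSet => {ω : Config G |
      Joined (edgeEnds G) (openEdges R ω) u v ∧ Joined (edgeEnds G) (openEdges R ω) u' v'} :=
    fun R R' h ω hω => ⟨joined_openEdges_mono h hω.1, joined_openEdges_mono h hω.2⟩
  have hU : {ω : Config G | Connected ω u v ∧ Connected ω u' v'} = ⋃ R : Finset G.edgeSet,
      {ω | Joined (edgeEnds G) (openEdges R ω) u v ∧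
        Joined (edgeEnds G) (openEdges R ω) u' v'} := by
    ext ω
    simp only [Set.mem_ofPred_eq, Set.mem_iUnion, connected_iff_exists_joined]
    constructor
    · rintro ⟨⟨R, h⟩, R', h'⟩
      exact ⟨R ∪ R', joined_openEdges_mono Finset.subset_union_left h,
        joined_openEdges_mono Finset.subset_union_right h'⟩
    · rintro ⟨R, h, h'⟩
      exact ⟨⟨R, h⟩, R, h'⟩
  rw [hU]
  exact (ENNReal.tendsto_toReal (measure_ne_top _ _)).comp (tendsto_measure_iUnion_atTop hm)

/-- The covariance form of the inequality. -/
theorem prob_connected_le [Countable V] (p : G.edgeSet → unitInterval) (a b c : V) :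
    2 * prob p {ω : Config G | Connected ω a b ∧ Connected ω a c} -
        prob p {ω : Config G | Connected ω b c} +
        prob p {ω : Config G | Connected ω a b ∧ Connected ω a c} ^ 2 ≤
      2 * prob p {ω : Config G | Connected ω a b} * prob p {ω : Config G | Connected ω a c} := by
  have t := tendsto_prob_joined p a b a c
  have x := tendsto_prob_joined p a b a b
  have y := tendsto_prob_joined p a c a c
  have z := tendsto_prob_joined p b c b c
  simp only [and_self] at x y z
  refine le_of_tendsto_of_tendsto' (((t.const_mul 2).sub z).add (t.pow 2))
    ((x.const_mul 2).mul y) fun R => ?_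
  have key := expect_joined_le (ends := edgeEnds G) (p := fun e => (p e : ℝ))
    (fun e => (p e).2.1) (fun e => (p e).2.2) a b c R
  simpa only [← prob_openEdges p R] using key

end Transfer

/-! ### Block events and the numerical bound -/

section Blocks

variable {V : Type*} {G : SimpleGraph V}

theorem connected_comm {ω : Config G} {u v : V} : Connected ω u v ↔ Connected ω v u :=
  ⟨SimpleGraph.Reachable.symm, SimpleGraph.Reachable.symm⟩

theorem connected_refl (ω : Config G) (u : V) : Connected ω u u := SimpleGraph.Reachable.refl u

theorem Connected.trans {ω : Config G} {u v w : V} (h : Connected ω u v) (h' : Connected ω v w) :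
    Connected ω u w :=
  SimpleGraph.Reachable.trans h h'

theorem clusterEvent_pair (a b : V) : clusterEvent G [[a, b]] = {ω | Connected ω a b} := by
  ext ω
  simp [clusterEvent, connected_refl, connected_comm (u := b) (v := a)]

theorem clusterEvent_sep (a b : V) : clusterEvent G [[a], [b]] = {ω | Connected ω a b}ᶜ := by
  ext ω
  simp [clusterEvent, connected_refl]

theorem clusterEvent_triple (a b c : V) :
    clusterEvent G [[a, b, c]] = {ω | Connected ω a b ∧ Connected ω a c} := by
  ext ω
  have : Connected ω a b → Connected ω a c → Connected ω b c :=
    fun h h' => (connected_comm.1 h).trans h'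
  simp only [clusterEvent, List.mem_cons, List.not_mem_nil, or_false, forall_eq_or_imp, forall_eq,
    connected_refl, List.pairwise_singleton, and_true, true_and, Set.mem_ofPred_eq,
    connected_comm (u := b) (v := a), connected_comm (u := c)]
  tauto

theorem clusterEvent_pair_sep (a b c : V) :
    clusterEvent G [[a, b], [c]] =
      {ω | Connected ω a b} \ {ω | Connected ω a b ∧ Connected ω a c} := by
  ext ω
  have : Connected ω a b → Connected ω b c → Connected ω a c := fun h h' => h.trans h'
  have : Connected ω a b → Connected ω a c → Connected ω b c :=
    fun h h' => (connected_comm.1 h).trans h'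
  simp [clusterEvent, connected_refl, connected_comm (u := b) (v := a)]
  tauto

theorem clusterEvent_sep_pair (a b c : V) :
    clusterEvent G [[a], [b, c]] =
      {ω | Connected ω b c} \ {ω | Connected ω a b ∧ Connected ω a c} := by
  ext ω
  have : Connected ω b c → Connected ω a b → Connected ω a c := fun h h' => h'.trans h
  have : Connected ω b c → Connected ω a c → Connected ω a b :=
    fun h h' => h'.trans (connected_comm.1 h)
  simp [clusterEvent, connected_refl, connected_comm (u := c) (v := b)]
  tauto

theorem clusterEvent_sep_sep (a b c : V) :
    clusterEvent G [[a], [b], [c]] =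
      ({ω | Connected ω a b} ∪ {ω | Connected ω a c} ∪ {ω | Connected ω b c})ᶜ := by
  ext ω
  simp [clusterEvent, connected_refl, and_assoc]

theorem connected_and_swap (a b c : V) :
    {ω : Config G | Connected ω a c ∧ Connected ω a b} =
      {ω | Connected ω a b ∧ Connected ω a c} :=
  Set.ext fun _ => and_comm

theorem connected_and_rotate (a b c : V) :
    {ω : Config G | Connected ω b a ∧ Connected ω b c} =
      {ω | Connected ω a b ∧ Connected ω a c} := by
  ext ω
  constructor
  · exact fun h => ⟨connected_comm.1 h.1, (connected_comm.1 h.1).trans h.2⟩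
  · exact fun h => ⟨connected_comm.1 h.1, (connected_comm.1 h.1).trans h.2⟩

variable [Countable V]

theorem measurableSet_connected_and (a b c : V) :
    MeasurableSet {ω : Config G | Connected ω a b ∧ Connected ω a c} :=
  (measurableSet_connected G a b).inter (measurableSet_connected G a c)

theorem prob_pair_sep (p : G.edgeSet → unitInterval) (a b c : V) :
    prob p (clusterEvent G [[a, b], [c]]) =
      prob p {ω | Connected ω a b} - prob p {ω : Config G | Connected ω a b ∧ Connected ω a c} := by
  rw [clusterEvent_pair_sep]
  exact measureReal_sdiff (fun ω h => h.1) (measurableSet_connected_and a b c)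

theorem prob_sep_pair (p : G.edgeSet → unitInterval) (a b c : V) :
    prob p (clusterEvent G [[a], [b, c]]) =
      prob p {ω | Connected ω b c} - prob p {ω : Config G | Connected ω a b ∧ Connected ω a c} := by
  rw [clusterEvent_sep_pair]
  exact measureReal_sdiff (fun ω h => (connected_comm.1 h.1).trans h.2)
    (measurableSet_connected_and a b c)

theorem prob_union (p : G.edgeSet → unitInterval) (a b c : V) :
    prob p ({ω : Config G | Connected ω a b} ∪ {ω | Connected ω a c}) =
      prob p {ω : Config G | Connected ω a b} + prob p {ω : Config G | Connected ω a c} -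
        prob p {ω : Config G | Connected ω a b ∧ Connected ω a c} := by
  have := measureReal_union_add_inter (μ := law G p) (s := {ω : Config G | Connected ω a b})
    (measurableSet_connected G a c)
  simp only [prob]
  rw [← this]
  simp [Set.ofPred_and]

theorem prob_sep_sep (p : G.edgeSet → unitInterval) (a b c : V) :
    prob p (clusterEvent G [[a], [b], [c]]) =
      1 - prob p {ω : Config G | Connected ω a b} - prob p {ω : Config G | Connected ω a c} -
        prob p {ω : Config G | Connected ω b c} +
        2 * prob p {ω : Config G | Connected ω a b ∧ Connected ω a c} := by
  have hU : MeasurableSet ({ω : Config G | Connected ω a b} ∪ {ω | Connected ω a c}) :=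
    (measurableSet_connected G a b).union (measurableSet_connected G a c)
  have hI : ({ω : Config G | Connected ω a b} ∪ {ω | Connected ω a c}) ∩ {ω | Connected ω b c} =
      {ω : Config G | Connected ω a b ∧ Connected ω a c} := by
    ext ω
    constructor
    · rintro ⟨h | h, hbc⟩
      · exact ⟨h, h.trans hbc⟩
      · exact ⟨h.trans (connected_comm.1 hbc), h⟩
    · exact fun h => ⟨Or.inl h.1, (connected_comm.1 h.1).trans h.2⟩
  have h₁ := measureReal_union_add_inter (μ := law G p)
    (s := {ω : Config G | Connected ω a b} ∪ {ω | Connected ω a c})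
    (measurableSet_connected G b c)
  have h₂ := prob_union p a b c
  rw [clusterEvent_sep_sep, prob, probReal_compl_eq_one_sub
    (hU.union (measurableSet_connected G b c))]
  rw [hI] at h₁
  simp only [prob] at h₂ ⊢
  linarith

theorem prob_mul_le (p : G.edgeSet → unitInterval) (a b c : V) :
    prob p (clusterEvent G [[a], [b]] ∩ clusterEvent G [[a], [c]]) *
        prob p (clusterEvent G [[a, b]] ∪ clusterEvent G [[a, c]]) ≤
      prob p (clusterEvent G [[a, b], [c]]) + prob p (clusterEvent G [[a, c], [b]]) +
        prob p (clusterEvent G [[a], [b, c]]) -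
        prob p (clusterEvent G [[a, b], [c]]) ^ 2 - prob p (clusterEvent G [[a, c], [b]]) ^ 2 := by
  have hU : MeasurableSet ({ω : Config G | Connected ω a b} ∪ {ω | Connected ω a c}) :=
    (measurableSet_connected G a b).union (measurableSet_connected G a c)
  have hc : prob p ({ω : Config G | Connected ω a b} ∪ {ω | Connected ω a c})ᶜ =
      1 - prob p ({ω : Config G | Connected ω a b} ∪ {ω | Connected ω a c}) :=
    probReal_compl_eq_one_sub hU
  rw [clusterEvent_sep, clusterEvent_sep, ← Set.compl_union, hc, clusterEvent_pair,
    clusterEvent_pair, prob_union, prob_pair_sep, prob_pair_sep, prob_sep_pair,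
    connected_and_swap a b c]
  -- The right side minus the left side of the goal is exactly 2AB - (2t - C + t²).
  have key := prob_connected_le p a b c
  nlinarith [key]

/-- If both probabilities equal m, the summed inequality becomes 7m² + 11m ≤ 5; the positive root,
about 0.3683, is rounded up to 0.369. -/
theorem min_prob_le (p : G.edgeSet → unitInterval) (a b c : V) :
    min (prob p (clusterEvent G [[a, b, c]])) (prob p (clusterEvent G [[a], [b], [c]])) ≤
      0.369 := by
  by_contra! hlt
  obtain ⟨ht, hs⟩ := lt_min_iff.1 hlt
  have comm : ∀ u v : V, {ω : Config G | Connected ω u v} = {ω | Connected ω v u} :=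
    fun u v => Set.ext fun _ => connected_comm
  have ha := prob_connected_le p a b c
  have hb := prob_connected_le p b a c
  have hc := prob_connected_le p c a b
  rw [connected_and_rotate] at hb
  rw [connected_and_rotate a c b, connected_and_swap a b c] at hc
  rw [comm b a] at hb
  rw [comm c a, comm c b] at hc
  have hx : 0 ≤ prob p (clusterEvent G [[a, b], [c]]) := measureReal_nonneg
  have hy : 0 ≤ prob p (clusterEvent G [[a, c], [b]]) := measureReal_nonneg
  have hz : 0 ≤ prob p (clusterEvent G [[a], [b, c]]) := measureReal_nonneg
  rw [prob_pair_sep] at hx hy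
  rw [connected_and_swap a b c] at hy
  rw [prob_sep_pair] at hz
  rw [clusterEvent_triple] at ht
  rw [prob_sep_sep] at hs
  generalize prob p {ω : Config G | Connected ω a b ∧ Connected ω a c} = t at *
  generalize prob p {ω : Config G | Connected ω a b} = A at *
  generalize prob p {ω : Config G | Connected ω a c} = B at *
  generalize prob p {ω : Config G | Connected ω b c} = C at *
  obtain ⟨x, rfl⟩ : ∃ x, A = x + t := ⟨A - t, by ring⟩
  obtain ⟨y, rfl⟩ : ∃ y, B = y + t := ⟨B - t, by ring⟩
  obtain ⟨z, rfl⟩ : ∃ z, C = z + t := ⟨C - t, by ring⟩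
  -- Sum of the three inequalities, using xy + yz + zx ≤ (x + y + z)²/3.
  have hw : 3 * t + 3 * t ^ 2 - (x + y + z) ≤
      2 / 3 * (x + y + z) ^ 2 + 4 * (x + y + z) * t + 6 * t ^ 2 := by
    nlinarith [sq_nonneg (x - y), sq_nonneg (y - z), sq_nonneg (x - z)]
  have hw₀ : 0 ≤ x + y + z := by linarith
  have hw₁ : x + y + z < 0.631 - t := by linarith
  generalize x + y + z = w at hw hw₀ hw₁
  -- The increment of w + (2/3)w² + 4wt from w to its upper bound 0.631 - t, which eliminates w.
  have h₁ : 0 ≤ (0.631 - t - w) * (1 + 2 / 3 * (w + (0.631 - t)) + 4 * t) :=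
    mul_nonneg (by linarith) (by nlinarith)
  nlinarith [mul_pos (sub_pos.2 ht) (sub_pos.2 ht)]

end Blocks

end BondPercolation

theorem mainTheorem7 :
    (∀ {V : Type*} [Countable V] (G : SimpleGraph V) (p : G.edgeSet → unitInterval) (a b c : V),
      BondPercolation.prob p
            (BondPercolation.clusterEvent G [[a], [b]] ∩ BondPercolation.clusterEvent G [[a], [c]]) *
          BondPercolation.prob p
            (BondPercolation.clusterEvent G [[a, b]] ∪ BondPercolation.clusterEvent G [[a, c]]) ≤
        BondPercolation.prob p (BondPercolation.clusterEvent G [[a, b], [c]]) +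
            BondPercolation.prob p (BondPercolation.clusterEvent G [[a, c], [b]]) +
            BondPercolation.prob p (BondPercolation.clusterEvent G [[a], [b, c]]) -
          BondPercolation.prob p (BondPercolation.clusterEvent G [[a, b], [c]]) ^ 2 -
          BondPercolation.prob p (BondPercolation.clusterEvent G [[a, c], [b]]) ^ 2 ∧
      BondPercolation.prob p (BondPercolation.clusterEvent G [[a, b], [c]]) +
            BondPercolation.prob p (BondPercolation.clusterEvent G [[a, c], [b]]) +
            BondPercolation.prob p (BondPercolation.clusterEvent G [[a], [b, c]]) -
          BondPercolation.prob p (BondPercolation.clusterEvent G [[a, b], [c]]) ^ 2 -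
          BondPercolation.prob p (BondPercolation.clusterEvent G [[a, c], [b]]) ^ 2 ≤
        BondPercolation.prob p (BondPercolation.clusterEvent G [[a, b], [c]]) +
          BondPercolation.prob p (BondPercolation.clusterEvent G [[a, c], [b]]) +
          BondPercolation.prob p (BondPercolation.clusterEvent G [[a], [b, c]])) ∧
      BondPercolation.alpha3 ≤ 0.369 := by
  refine ⟨fun G p a b c => ⟨BondPercolation.prob_mul_le p a b c, ?_⟩, ?_⟩
  · linarith [sq_nonneg (BondPercolation.prob p (BondPercolation.clusterEvent G [[a, b], [c]])),
      sq_nonneg (BondPercolation.prob p (BondPercolation.clusterEvent G [[a, c], [b]]))]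
  · refine csSup_le ⟨_, Unit, inferInstance, ⊥, fun _ => 0, (), (), (), rfl⟩ ?_
    rintro x ⟨V, _, G, p, a, b, c, rfl⟩
    exact BondPercolation.min_prob_le p a b c
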